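/- Let $(\Omega,\nu)$ be an atomless Borel probability space (an atomless probability measure on a standard Borel space), let $W:\Omega^2\to[0,1]$ be a graphon, that is, a symmetric measurable function, and let $F$ be a finite simple graph with vertex set $[k]$. Put $W^{\otimes F}(x_1,\dots,x_k)=\prod_{1\le i<j\le k,\ ij\in E(F)}W(x_i,x_j)$ and $\mathcal F_F(W)=\{\mathbf x\in\Omega^k: W^{\otimes F}(\mathbf x)\neq 0\}$. An *$F$-tiling* in $W$ is a measurable function $\mathfrak t:\Omega^k\to[0,\infty)$ with $\{\mathfrak t\ne0\}\subseteq\mathcal F_F(W)$ and, for every $x\in\Omega$, $$\sum_{\ell=1}^{k}\int_{\Omega^{k-1}}\mathfrak t(x_1,\dots,x_{\ell-1},x,x_{\ell+1},\dots,x_k)\,\mathrm d\nu^{k-1}(x_1,\dots,x_{\ell-1},x_{\ell+1},\dots,x_k)\le 1.$$ The *$F$-tiling number* $\mathsf{til}(F,W)$ is the supremum of $\int_{\Omega^k}\mathfrak t\,\mathrm d\nu^k$ over all $F$-tilings $\mathfrak t$ in $W$. A *fractional $F$-cover* of $W$ is a measurable function $\mathfrak c:\Omega\to[0,1]$ with $$\nu^k\Big(\mathcal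 F_F(W)\cap\big\{(x_1,\dots,x_k)\in\Omega^k:\textstyle\sum_{i=1}^k\mathfrak c(x_i)<1\big\}\Big)=0.$$ The *fractional $F$-cover number* $\mathsf{fcov}(F,W)$ is the infimum of $\int_\Omega\mathfrak c\,\mathrm d\nu$ over all fractional $F$-covers $\mathfrak c$ of $W$. Then $\mathsf{til}(F,W)=\mathsf{fcov}(F,W)$, the supremum and the infimum being taken in $[0,\infty]$. -/

import Mathlib

open MeasureTheory
open scoped ENNReal NNReal

/-- A graphon on `Ω`: a symmetric measurable function `Ω × Ω → [0,1]`. -/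
structure Graphon (Ω : Type*) [MeasurableSpace Ω] where
  /-- the underlying function of two variables -/
  val : Ω → Ω → ℝ
  measurable_val : Measurable (Function.uncurry val)
  val_mem_Icc : ∀ x y, val x y ∈ Set.Icc (0 : ℝ) 1
  val_symm : ∀ x y, val x y = val y x

namespace Graphon

variable {Ω : Type*} [MeasurableSpace Ω] {V : Type*} [Fintype V]

/-- The value `W (x i) (x j)` as a function of the unordered pair `{i, j}`. -/
def onPair (W : Graphon Ω) (x : V → Ω) : Sym2 V → ℝ :=
  Sym2.lift ⟨fun i j => W.val (x i) (x j), fun i j => W.val_symm (x i) (x j)⟩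

open Classical in
/-- The density `W^{⊗F}(x) = ∏_{ij ∈ E(F)} W(x_i, x_j)` of the finite graph `F` in `W`. -/
noncomputable def density (W : Graphon Ω) (F : SimpleGraph V) (x : V → Ω) : ℝ :=
  ∏ e ∈ F.edgeFinset, W.onPair x e

/-- The set of copies of `F` in `W`: the support of `W^{⊗F}`. -/
def copies (W : Graphon Ω) (F : SimpleGraph V) : Set (V → Ω) :=
  Function.support (W.density F)

open Classical in
/-- The point of `Ω^V` with coordinate `x` at `l` and the coordinates `y` elsewhere. -/
noncomputable def insertAt (l : V) (x : Ω) (y : {i : V // i ≠ l} → Ω) : V → Ω :=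
  fun i => if h : i = l then x else y ⟨i, h⟩

open Classical in
/-- `t : Ω^V → [0,∞)` is an `F`-tiling in `W`: it is measurable, supported on the copies of `F`,
and for every `x` the integrals of `t` over the sections `{x_l = x}`, summed over the vertices `l`
of `F`, give at most `1`. -/
structure IsTiling (ν : Measure Ω) (W : Graphon Ω) (F : SimpleGraph V)
    (t : (V → Ω) → ℝ≥0) : Prop where
  measurable : Measurable t
  support_subset : Function.support t ⊆ W.copies F
  sum_lintegral_le_one : ∀ x : Ω,
    ∑ l : V, ∫⁻ y, (t (insertAt l x y) : ℝ≥0∞)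
      ∂(Measure.pi (fun _ : {i : V // i ≠ l} => ν)) ≤ 1

/-- The `F`-tiling number of `W`: the supremum, in `[0,∞]`, of the sizes `∫ t dν^V` of
`F`-tilings `t` in `W`. -/
noncomputable def til (ν : Measure Ω) (F : SimpleGraph V) (W : Graphon Ω) : ℝ≥0∞ :=
  ⨆ (t : (V → Ω) → ℝ≥0) (_ : IsTiling ν W F t),
    ∫⁻ x, (t x : ℝ≥0∞) ∂(Measure.pi (fun _ : V => ν))

/-- `c : Ω → [0,1]` is a fractional `F`-cover of `W`: it is measurable, and almost no copy of `F`
in `W` has total `c`-weight less than `1`. -/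
structure IsFractionalCover (ν : Measure Ω) (W : Graphon Ω) (F : SimpleGraph V)
    (c : Ω → ℝ≥0) : Prop where
  measurable : Measurable c
  le_one : ∀ x, c x ≤ 1
  measure_uncovered :
    Measure.pi (fun _ : V => ν) (W.copies F ∩ {x | ∑ i, c (x i) < 1}) = 0

/-- The fractional `F`-cover number of `W`: the infimum, in `[0,∞]`, of the sizes `∫ c dν` of
fractional `F`-covers `c` of `W`. -/
noncomputable def fcov (ν : Measure Ω) (F : SimpleGraph V) (W : Graphon Ω) : ℝ≥0∞ :=
  ⨅ (c : Ω → ℝ≥0) (_ : IsFractionalCover ν W F c), ∫⁻ x, (c x : ℝ≥0∞) ∂ν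

end Graphon

/-! Linear programming duality, obtained by a quadratic penalty. Weak duality is double counting
(`lintegral_mul_sum_eq`). For the converse let `D` be the deficit of `c` and let `c` nearly minimise
`∫ c + r ∫ D²` over measurable `[0,1]`-valued functions. The multiplier `t = 2rD` is almost a
tiling: scaling it down where its section mass `M` exceeds 1 costs at most `∫ (M - 1)⁺`
(`exists_lintegral_add_le_til_add`). That loss is `∫ d (M - 1)` with `d` the indicator of `{M > 1}`,
and near-optimality of `c` in the direction `d - c` yields `∫ c + 2r ∫ D² ≤ til + δ`.

So for every `n` there are functions of integral at most `til + ε n` and squared deficit at most `ε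
n`. These form decreasing convex sets; nearly norm-minimal points in them are Cauchy in L² by the
parallelogram law, and their almost everywhere limit is a fractional cover of size at most `til`. -/

namespace Graphon

/-! ### Section masses and double counting -/

section Sections

@[simp]
lemma insertAt_self {Ω V : Type*} (l : V) (x : Ω) (y : {i : V // i ≠ l} → Ω) : insertAt l x y l = x := by
  simp [insertAt]

lemma insertAt_of_ne {Ω V : Type*} {l i : V} (h : i ≠ l) (x : Ω) (y : {i : V // i ≠ l} → Ω) :
    insertAt l x y i = y ⟨i, h⟩ := by
  simp [insertAt, h]

variable {Ω : Type*} [MeasurableSpace Ω] {V : Type*}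

lemma measurable_insertAt (l : V) :
    Measurable fun p : Ω × ({i : V // i ≠ l} → Ω) => insertAt l p.1 p.2 := by
  refine measurable_pi_lambda _ fun i => ?_
  by_cases h : i = l
  · subst h
    simpa using measurable_fst
  · simp only [insertAt_of_ne h]
    fun_prop

variable [Fintype V]

open Classical in
lemma measurePreserving_insertAt (ν : Measure Ω) [SigmaFinite ν] (l : V) :
    MeasurePreserving (fun p : Ω × ({i : V // i ≠ l} → Ω) => insertAt l p.1 p.2)
      (ν.prod (Measure.pi fun _ => ν)) (Measure.pi fun _ : V => ν) := by
  refine ⟨measurable_insertAt l, (Measure.pi_eq fun s hs => ?_).symm⟩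
  rw [Measure.map_apply (measurable_insertAt l) (MeasurableSet.univ_pi hs)]
  have h : (fun p : Ω × ({i : V // i ≠ l} → Ω) => insertAt l p.1 p.2) ⁻¹' Set.univ.pi s
      = s l ×ˢ Set.univ.pi fun i : {i : V // i ≠ l} => s i := by
    ext ⟨x, y⟩
    simp only [Set.mem_preimage, Set.mem_univ_pi, Set.mem_prod]
    refine ⟨fun h => ⟨by simpa using h l, fun i => ?_⟩, fun h i => ?_⟩
    · simpa [insertAt_of_ne i.2] using h i
    · by_cases hi : i = l
      · subst hi
        simpa using h.1
      · simpa [insertAt_of_ne hi] using h.2 ⟨i, hi⟩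
  rw [h, Measure.prod_prod, Measure.pi_pi, Fintype.prod_eq_mul_prod_subtype_ne _ l]

open Classical in
/-- The total integral of `t` over the sections through `x`, one section for each vertex. -/
noncomputable def sectionMass (ν : Measure Ω) (t : (V → Ω) → ℝ≥0∞) (x : Ω) : ℝ≥0∞ :=
  ∑ l : V, ∫⁻ y, t (insertAt l x y) ∂(Measure.pi (fun _ : {i : V // i ≠ l} => ν))

variable {ν : Measure Ω}

lemma measurable_sectionMass [SigmaFinite ν] {t : (V → Ω) → ℝ≥0∞}
    (ht : Measurable t) : Measurable (sectionMass ν t) := by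
  classical
  refine Finset.measurable_sum _ fun l _ => ?_
  exact Measurable.lintegral_prod_right (ht.comp (measurable_insertAt l))

lemma sectionMass_lt_top [IsProbabilityMeasure ν] {t : (V → Ω) → ℝ≥0∞} {C : ℝ≥0∞}
    (hC : C ≠ ∞) (ht : ∀ x, t x ≤ C) (x : Ω) : sectionMass ν t x < ∞ := by
  classical
  refine ENNReal.sum_lt_top.2 fun l _ => ?_
  calc _ ≤ ∫⁻ _, C ∂(Measure.pi (fun _ : {i : V // i ≠ l} => ν)) := lintegral_mono fun y => ht _
    _ < ∞ := by simpa using hC.lt_top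

/-- Double counting: weighting each point of `Ω^V` by the total `c`-weight of its coordinates
amounts to weighting the section masses by `c`. -/
lemma lintegral_mul_sum_eq [SigmaFinite ν] {t : (V → Ω) → ℝ≥0∞} {c : Ω → ℝ≥0∞}
    (ht : Measurable t) (hc : Measurable c) :
    ∫⁻ x, t x * ∑ i, c (x i) ∂(Measure.pi fun _ : V => ν)
      = ∫⁻ x, c x * sectionMass ν t x ∂ν := by
  classical
  simp only [Finset.mul_sum, sectionMass]
  rw [lintegral_finsetSum _ fun l _ => by fun_prop, lintegral_finsetSum]
  · refine Finset.sum_congr rfl fun l _ => ?_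
    rw [← (measurePreserving_insertAt ν l).lintegral_comp (by fun_prop), lintegral_prod]
    · refine lintegral_congr fun x => ?_
      simp only [insertAt_self]
      rw [lintegral_mul_const, mul_comm]
      exact ht.comp ((measurable_insertAt l).comp measurable_prodMk_left)
    · exact (Measurable.comp (g := fun x : V → Ω => t x * c (x l)) (by fun_prop)
        (measurable_insertAt l)).aemeasurable
  · exact fun l _ => hc.mul
      (Measurable.lintegral_prod_right (ht.comp (measurable_insertAt l)))

end Sections

/-! ### Weak duality and trimming -/

section Duality

variable {Ω : Type*} [MeasurableSpace Ω] {V : Type*} [Fintype V] {ν : Measure Ω}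
  {F : SimpleGraph V} {W : Graphon Ω}

lemma measurableSet_copies (W : Graphon Ω) (F : SimpleGraph V) :
    MeasurableSet (W.copies F) := by
  classical
  have h : ∀ e : Sym2 V, Measurable fun x : V → Ω => W.onPair x e := by
    intro e
    induction e with
    | _ i j =>
      have hij : Measurable fun x : V → Ω => (x i, x j) := by fun_prop
      exact W.measurable_val.comp hij
  exact measurableSet_support (Finset.measurable_prod _ fun e _ => h e)

/-- Weak duality: no tiling is larger than a fractional cover. -/
lemma til_le_fcov [SigmaFinite ν] : til ν F W ≤ fcov ν F W := by
  refine iSup₂_le fun t ht => le_iInf₂ fun c hc => ?_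
  have hcover : ∀ᵐ x ∂(Measure.pi fun _ : V => ν), x ∈ W.copies F → 1 ≤ ∑ i, c (x i) := by
    rw [ae_iff]
    convert hc.measure_uncovered using 2
    ext x
    simp
  calc ∫⁻ x, (t x : ℝ≥0∞) ∂(Measure.pi fun _ : V => ν)
      ≤ ∫⁻ x, (t x : ℝ≥0∞) * ∑ i, (c (x i) : ℝ≥0∞) ∂(Measure.pi fun _ : V => ν) := by
        refine lintegral_mono_ae (hcover.mono fun x hx => ?_)
        by_cases h : t x = 0
        · simp [h]
        · have := hx (ht.support_subset h)
          calc (t x : ℝ≥0∞) = t x * 1 := by simp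
            _ ≤ _ := by gcongr; exact_mod_cast this
    _ = ∫⁻ x, (c x : ℝ≥0∞) * sectionMass ν (fun x => (t x : ℝ≥0∞)) x ∂ν :=
        lintegral_mul_sum_eq ht.measurable.coe_nnreal_ennreal hc.measurable.coe_nnreal_ennreal
    _ ≤ ∫⁻ x, (c x : ℝ≥0∞) ∂ν := by
        refine lintegral_mono fun x => ?_
        calc _ ≤ (c x : ℝ≥0∞) * 1 := by gcongr; exact ht.sum_lintegral_le_one x
          _ = c x := by simp

/-- A bounded function supported on the copies of `F` can be trimmed to a tiling, at a cost
controlled by the indicator `d` of the points whose section mass exceeds `1`. -/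
lemma exists_lintegral_add_le_til_add [IsProbabilityMeasure ν] {t : (V → Ω) → ℝ≥0}
    (ht : Measurable t) (hts : Function.support t ⊆ W.copies F) {C : ℝ≥0} (htC : ∀ x, t x ≤ C) :
    ∃ d : Ω → ℝ≥0, Measurable d ∧ (∀ x, d x ≤ 1) ∧
      ∫⁻ x, (t x : ℝ≥0∞) ∂(Measure.pi fun _ : V => ν) + ∫⁻ x, (d x : ℝ≥0∞) ∂ν
        ≤ til ν F W
          + ∫⁻ x, (t x : ℝ≥0∞) * ∑ i, (d (x i) : ℝ≥0∞) ∂(Measure.pi fun _ : V => ν) := by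
  classical
  set M := sectionMass ν fun x => (t x : ℝ≥0∞) with hM
  have hMm : Measurable M := measurable_sectionMass ht.coe_nnreal_ennreal
  have hMtop : ∀ x, M x ≠ ∞ := fun x =>
    (sectionMass_lt_top (C := C) ENNReal.coe_ne_top (fun x => by exact_mod_cast htC x) x).ne
  set m : Ω → ℝ≥0 := fun x => (M x).toNNReal with hm
  have hmm : Measurable m := hMm.ennreal_toNNReal
  have hmM : ∀ x, (m x : ℝ≥0∞) = M x := fun x => ENNReal.coe_toNNReal (hMtop x)
  -- Multiplying a section mass by `1 - g` brings it down to at most 1. The factor `1 - ∑ i, g (x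
  -- i)` in `t'` is at most `1 - g` at every coordinate, so it serves all sections at once.
  set g : Ω → ℝ≥0 := fun x => 1 - (max 1 (m x))⁻¹ with hg
  have hgm : Measurable g := by fun_prop
  set d : Ω → ℝ≥0 := {x | 1 < m x}.indicator 1 with hd
  have hdm : Measurable d :=
    measurable_one.indicator (measurableSet_lt measurable_const hmm)
  set t' : (V → Ω) → ℝ≥0 := fun x => t x * (1 - ∑ i, g (x i)) with ht'
  have ht'm : Measurable t' := by fun_prop
  have hinv : ∀ x, (max 1 (m x))⁻¹ ≤ 1 := fun x => inv_le_one_of_one_le₀ (le_max_left _ _)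
  have htil : IsTiling ν W F t' := by
    refine ⟨ht'm, fun x hx => hts fun h => hx (by simp [ht', h]), fun x => ?_⟩
    calc _ ≤ ∑ l : V, ∫⁻ y, (t (insertAt l x y) : ℝ≥0∞) * ((max 1 (m x))⁻¹ : ℝ≥0)
            ∂(Measure.pi (fun _ : {i : V // i ≠ l} => ν)) := by
          refine Finset.sum_le_sum fun l _ => lintegral_mono fun y => ?_
          rw [← ENNReal.coe_mul, ENNReal.coe_le_coe]
          simp only [ht']
          gcongr
          have h1 : g x ≤ ∑ i, g (insertAt l x y i) := by
            simpa using Finset.single_le_sum (f := fun i => g (insertAt l x y i))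
              (fun i _ => zero_le) (Finset.mem_univ l)
          calc 1 - ∑ i, g (insertAt l x y i) ≤ 1 - g x := tsub_le_tsub_left h1 1
            _ = _ := tsub_tsub_cancel_of_le (hinv x)
      _ = M x * ((max 1 (m x))⁻¹ : ℝ≥0) := by
          rw [hM, sectionMass, Finset.sum_mul]
          refine Finset.sum_congr rfl fun l _ => lintegral_mul_const _ ?_
          exact (ht.comp ((measurable_insertAt l).comp measurable_prodMk_left)).coe_nnreal_ennreal
      _ ≤ 1 := by
          rw [← hmM, ← ENNReal.coe_mul, ENNReal.coe_le_one_iff, ← div_eq_mul_inv]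
          exact div_le_one_of_le₀ (le_max_right _ _) zero_le
  refine ⟨d, hdm, fun x => ?_, ?_⟩
  · by_cases h : 1 < m x <;> simp [hd, h]
  -- Both `g * m` and `d * m - d` are the excess `(m - 1)⁺`.
  have hpt : ∀ x, g x * m x + d x ≤ d x * m x := by
    intro x
    by_cases h : 1 < m x
    · have h0 : m x ≠ 0 := (zero_lt_one.trans h).ne'
      have hdx : d x = 1 := by simp [hd, h]
      have hgx : g x = 1 - (m x)⁻¹ := by simp [hg, max_eq_right h.le]
      rw [hdx, hgx, tsub_mul, inv_mul_cancel₀ h0, one_mul, tsub_add_cancel_of_le h.le]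
    · have hdx : d x = 0 := by simp [hd, h]
      have hgx : g x = 0 := by simp [hg, max_eq_left (not_lt.1 h)]
      simp [hdx, hgx]
  have htt : ∀ x, t x ≤ t' x + t x * ∑ i, g (x i) := by
    intro x
    calc t x = t x * 1 := by simp
      _ ≤ t x * (1 - ∑ i, g (x i) + ∑ i, g (x i)) := by gcongr; exact le_tsub_add
      _ = _ := by rw [mul_add]
  calc ∫⁻ x, (t x : ℝ≥0∞) ∂(Measure.pi fun _ : V => ν) + ∫⁻ x, (d x : ℝ≥0∞) ∂ν
      ≤ ∫⁻ x, ((t' x : ℝ≥0∞) + t x * ∑ i, (g (x i) : ℝ≥0∞)) ∂(Measure.pi fun _ : V => ν)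
          + ∫⁻ x, (d x : ℝ≥0∞) ∂ν := by
        gcongr with x
        exact_mod_cast htt x
    _ = ∫⁻ x, (t' x : ℝ≥0∞) ∂(Measure.pi fun _ : V => ν)
          + ∫⁻ x, ((g x : ℝ≥0∞) * M x + d x) ∂ν := by
        rw [lintegral_add_left ht'm.coe_nnreal_ennreal,
          lintegral_mul_sum_eq ht.coe_nnreal_ennreal hgm.coe_nnreal_ennreal,
          lintegral_add_right _ hdm.coe_nnreal_ennreal, add_assoc]
    _ ≤ til ν F W + ∫⁻ x, (d x : ℝ≥0∞) * M x ∂ν := by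
        gcongr with x
        · exact le_iSup₂ (f := fun (t : (V → Ω) → ℝ≥0) (_ : IsTiling ν W F t) =>
            ∫⁻ x, (t x : ℝ≥0∞) ∂(Measure.pi fun _ : V => ν)) t' htil
        · rw [← hmM]
          exact_mod_cast hpt x
    _ = _ := by rw [lintegral_mul_sum_eq ht.coe_nnreal_ennreal hdm.coe_nnreal_ennreal]

end Duality

end Graphon

/-! ### Almost everywhere convergence from midpoint convexity -/

open Filter Topology in
/-- Points chosen suitably from a decreasing sequence of nonempty, midpoint-convex sets of
measurable `[0,1]`-valued functions converge almost everywhere. -/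
lemma exists_ae_tendsto_of_antitone_of_midpoint_mem {Ω : Type*} [MeasurableSpace Ω]
    {ν : Measure Ω} [IsProbabilityMeasure ν] {K : ℕ → Set (Ω → ℝ)} (hanti : Antitone K)
    (hne : ∀ n, (K n).Nonempty) (hmeas : ∀ n, ∀ f ∈ K n, Measurable f)
    (hIcc : ∀ n, ∀ f ∈ K n, ∀ x, f x ∈ Set.Icc (0 : ℝ) 1)
    (hmid : ∀ n, ∀ f ∈ K n, ∀ g ∈ K n, (fun x => (f x + g x) / 2) ∈ K n) :
    ∃ (f : ℕ → Ω → ℝ) (f' : Ω → ℝ), (∀ n, f n ∈ K n) ∧ Measurable f' ∧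
      (∀ x, f' x ∈ Set.Icc (0 : ℝ) 1) ∧ ∀ᵐ x ∂ν, Tendsto (fun n => f n x) atTop (𝓝 (f' x)) := by
  set q : (Ω → ℝ) → ℝ := fun f => ∫ x, f x ^ 2 ∂ν with hq
  have hint : ∀ n, ∀ f ∈ K n, ∀ m, ∀ g ∈ K m, Integrable (fun x => f x * g x) ν := by
    intro n f hf m g hg
    refine Integrable.of_bound ((hmeas n f hf).mul (hmeas m g hg)).aestronglyMeasurable 1
      (ae_of_all _ fun x => ?_)
    have h1 := hIcc n f hf x
    have h2 := hIcc m g hg x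
    rw [Real.norm_of_nonneg (mul_nonneg h1.1 h2.1)]
    exact mul_le_one₀ h1.2 h2.1 h2.2
  have hint2 : ∀ n, ∀ f ∈ K n, Integrable (fun x => f x ^ 2) ν := fun n f hf => by
    simpa only [sq] using hint n f hf n f hf
  have hq0 : ∀ f, 0 ≤ q f := fun f => integral_nonneg fun x => sq_nonneg _
  have hq1 : ∀ n, ∀ f ∈ K n, q f ≤ 1 := by
    intro n f hf
    calc q f ≤ ∫ _, (1 : ℝ) ∂ν := integral_mono (hint2 n f hf) (integrable_const _) fun x =>
          pow_le_one₀ (hIcc n f hf x).1 (hIcc n f hf x).2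
      _ = 1 := by simp
  have hbdd : ∀ n, BddBelow (q '' K n) := fun n => ⟨0, by rintro _ ⟨f, -, rfl⟩; exact hq0 f⟩
  set e : ℕ → ℝ := fun n => sInf (q '' K n) with he
  have hele : ∀ n, ∀ f ∈ K n, e n ≤ q f := fun n f hf => csInf_le (hbdd n) ⟨f, hf, rfl⟩
  have hemono : Monotone e := fun m n hmn =>
    csInf_le_csInf (hbdd m) ((hne n).image _) (Set.image_mono (hanti hmn))
  have hebdd : BddAbove (Set.range e) := by
    refine ⟨1, ?_⟩
    rintro _ ⟨n, rfl⟩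
    obtain ⟨f, hf⟩ := hne n
    exact (hele n f hf).trans (hq1 n f hf)
  set l := ⨆ n, e n with hl
  -- Chosen so that `8 * ε N` is less than `((1 / 2) ^ N) ^ 2`, which makes the L² distances
  -- summable.
  set ε : ℕ → ℝ := fun n => (1 / 4) ^ n / 16 with hε
  have hεpos : ∀ n, 0 < ε n := fun n => by positivity
  have hεanti : Antitone ε := fun m n hmn =>
    div_le_div_of_nonneg_right (pow_le_pow_of_le_one (by norm_num) (by norm_num) hmn) (by norm_num)
  have hchoose : ∀ n, ∃ k, n ≤ k ∧ l - ε n ≤ e k ∧ ∃ f ∈ K k, q f ≤ l + ε n := by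
    intro n
    obtain ⟨k, hk⟩ := exists_lt_of_lt_ciSup (show l - ε n < ⨆ n, e n by linarith [hεpos n])
    refine ⟨max n k, le_max_left _ _, hk.le.trans (hemono (le_max_right _ _)), ?_⟩
    obtain ⟨_, ⟨f, hf, rfl⟩, hfl⟩ :=
      Real.lt_sInf_add_pos ((hne (max n k)).image q) (hεpos n)
    have := le_ciSup hebdd (max n k)
    exact ⟨f, hf, hfl.le.trans (by linarith)⟩
  choose k hnk hek f hfK hqf using hchoose
  have hfm : ∀ n, Measurable (f n) := fun n => hmeas _ _ (hfK n)
  -- Parallelogram law: both squared norms are at most `l + ε N`, while the midpoint lies in a set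
  -- where they are at least `l - ε N`.
  have hsq : ∀ N n m, N ≤ n → N ≤ m → ∫ x, (f n x - f m x) ^ 2 ∂ν ≤ 8 * ε N := by
    intro N n m hn hm
    have hmidK : (fun x => (f n x + f m x) / 2) ∈ K (min (k n) (k m)) :=
      hmid _ _ (hanti (min_le_left _ _) (hfK n)) _ (hanti (min_le_right _ _) (hfK m))
    have h1 : l - ε N ≤ e (min (k n) (k m)) := by
      rcases min_choice (k n) (k m) with h | h <;> rw [h]
      · linarith [hek n, hεanti hn]
      · linarith [hek m, hεanti hm]
    have h2 : ∫ x, (f n x - f m x) ^ 2 ∂ν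
        = 2 * q (f n) + 2 * q (f m) - 4 * q fun x => (f n x + f m x) / 2 := by
      simp only [hq]
      rw [← integral_const_mul, ← integral_const_mul, ← integral_const_mul, ← integral_add,
        ← integral_sub]
      · refine integral_congr_ae (ae_of_all _ fun x => ?_)
        simp only
        ring
      · exact ((hint2 _ _ (hfK n)).const_mul 2).add ((hint2 _ _ (hfK m)).const_mul 2)
      · exact (hint2 _ _ hmidK).const_mul 4
      · exact (hint2 _ _ (hfK n)).const_mul 2
      · exact (hint2 _ _ (hfK m)).const_mul 2
    rw [h2]
    linarith [hele _ _ hmidK, hqf n, hqf m, hεanti hn, hεanti hm]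
  have hae : ∀ᵐ x ∂ν, ∃ y, Tendsto (fun n => f n x) atTop (𝓝 y) := by
    refine Lp.ae_tendsto_of_cauchy_eLpNorm (p := 2) (B := fun n => ENNReal.ofReal ((1 / 2) ^ n))
      (fun n => (hfm n).aestronglyMeasurable) (by norm_num) ?_ fun N n m hn hm => ?_
    · rw [← ENNReal.ofReal_tsum_of_nonneg (fun n => by positivity)
        (summable_geometric_of_lt_one (by norm_num) (by norm_num))]
      exact ENNReal.ofReal_ne_top
    · have hmem : MemLp (f n - f m) 2 ν := by
        refine MemLp.of_bound ((hfm n).sub (hfm m)).aestronglyMeasurable 1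
          (ae_of_all _ fun x => ?_)
        have h1 := hIcc _ _ (hfK n) x
        have h2 := hIcc _ _ (hfK m) x
        rw [Real.norm_eq_abs, Pi.sub_apply, abs_le]
        constructor <;> linarith [h1.1, h1.2, h2.1, h2.2]
      rw [hmem.eLpNorm_eq_integral_rpow_norm (by norm_num) (by norm_num),
        ENNReal.ofReal_lt_ofReal_iff (by positivity)]
      have h3 : ∫ x, ‖(f n - f m) x‖ ^ (2 : ℝ≥0∞).toReal ∂ν = ∫ x, (f n x - f m x) ^ 2 ∂ν := by
        simp
      rw [h3, ENNReal.toReal_ofNat, show ((2 : ℝ)⁻¹) = 1 / 2 by norm_num, ← Real.sqrt_eq_rpow,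
        Real.sqrt_lt' (by positivity)]
      refine (hsq N n m hn hm).trans_lt ?_
      rw [← pow_mul, mul_comm N 2, pow_mul, show ((1 : ℝ) / 2) ^ 2 = 1 / 4 by norm_num]
      simp only [hε]
      have : (0 : ℝ) < (1 / 4) ^ N := by positivity
      linarith
  obtain ⟨g, hgm, hg⟩ := measurable_limit_of_tendsto_metrizable_ae
    (fun n => (hfm n).aemeasurable) hae
  -- The limit is uncontrolled on a null set, so it is clamped to `[0,1]`.
  refine ⟨f, fun x => max 0 (min 1 (g x)), fun n => hanti (hnk n) (hfK n), by fun_prop,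
    fun x => ⟨le_max_left _ _, max_le zero_le_one (min_le_left _ _)⟩, hg.mono fun x hx => ?_⟩
  have hc : Continuous fun y : ℝ => max 0 (min 1 y) := by fun_prop
  refine ((hc.tendsto _).comp hx).congr fun n => ?_
  have h1 := hIcc _ _ (hfK n) x
  simp [min_eq_right h1.2, max_eq_right h1.1]

namespace Graphon

/-! ### The penalised covering problem -/

section Deficit

variable {Ω : Type*} [MeasurableSpace Ω] {V : Type*} [Fintype V] {ν : Measure Ω}
  {F : SimpleGraph V} {W : Graphon Ω}

/-- The real-valued form of `exists_lintegral_add_le_til_add`. -/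
lemma exists_integral_add_le_til_add [IsProbabilityMeasure ν] (htil : til ν F W ≠ ∞)
    {t : (V → Ω) → ℝ} (ht : Measurable t) (hts : Function.support t ⊆ W.copies F) {C : ℝ}
    (ht0 : ∀ x, 0 ≤ t x) (htC : ∀ x, t x ≤ C) :
    ∃ d : Ω → ℝ, Measurable d ∧ (∀ x, d x ∈ Set.Icc (0 : ℝ) 1) ∧
      ∫ x, t x ∂(Measure.pi fun _ : V => ν) + ∫ x, d x ∂ν
        ≤ (til ν F W).toReal + ∫ x, t x * ∑ i, d (x i) ∂(Measure.pi fun _ : V => ν) := by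
  obtain ⟨d, hdm, hd1, hd⟩ := exists_lintegral_add_le_til_add (ν := ν) (F := F) (W := W)
    (t := fun x => (t x).toNNReal) ht.real_toNNReal
    (fun x hx => hts fun h => hx (by simp [h])) (C := C.toNNReal)
    (fun x => Real.toNNReal_le_toNNReal (htC x))
  have hd0 : ∀ x, 0 ≤ (d x : ℝ) := fun x => NNReal.coe_nonneg _
  have hd1' : ∀ x, (d x : ℝ) ≤ 1 := fun x => by exact_mod_cast hd1 x
  refine ⟨fun x => d x, hdm.coe_nnreal_real, fun x => ⟨hd0 x, hd1' x⟩, ?_⟩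
  have e1 : ∫⁻ x, ((t x).toNNReal : ℝ≥0∞) ∂(Measure.pi fun _ : V => ν)
      = ENNReal.ofReal (∫ x, t x ∂(Measure.pi fun _ : V => ν)) := by
    rw [ofReal_integral_eq_lintegral_ofReal _ (ae_of_all _ ht0)]
    · rfl
    · refine Integrable.of_bound ht.aestronglyMeasurable C (ae_of_all _ fun x => ?_)
      rw [Real.norm_of_nonneg (ht0 x)]
      exact htC x
  have e2 : ∫⁻ x, (d x : ℝ≥0∞) ∂ν = ENNReal.ofReal (∫ x, (d x : ℝ) ∂ν) := by
    rw [ofReal_integral_eq_lintegral_ofReal _ (ae_of_all _ hd0)]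
    · simp
    · refine Integrable.of_bound hdm.coe_nnreal_real.aestronglyMeasurable 1
        (ae_of_all _ fun x => ?_)
      rw [Real.norm_of_nonneg (hd0 x)]
      exact hd1' x
  have hnn : ∀ x : V → Ω, 0 ≤ t x * ∑ i, (d (x i) : ℝ) := fun x =>
    mul_nonneg (ht0 x) (Finset.sum_nonneg fun i _ => hd0 (x i))
  have e3 : ∫⁻ x, ((t x).toNNReal : ℝ≥0∞) * ∑ i, (d (x i) : ℝ≥0∞) ∂(Measure.pi fun _ : V => ν)
      = ENNReal.ofReal (∫ x, t x * ∑ i, (d (x i) : ℝ) ∂(Measure.pi fun _ : V => ν)) := by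
    rw [ofReal_integral_eq_lintegral_ofReal _ (ae_of_all _ hnn)]
    · refine lintegral_congr fun x => ?_
      rw [ENNReal.ofReal_mul (ht0 x), ENNReal.ofReal_sum_of_nonneg fun i _ => hd0 (x i)]
      simp [ENNReal.ofReal]
    · refine Integrable.of_bound (by fun_prop) (C * Fintype.card V) (ae_of_all _ fun x => ?_)
      rw [Real.norm_of_nonneg (hnn x)]
      refine mul_le_mul (htC x) ?_ (Finset.sum_nonneg fun i _ => hd0 (x i))
        ((ht0 x).trans (htC x))
      simpa using Finset.sum_le_sum fun i (_ : i ∈ Finset.univ) => hd1' (x i)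
  rw [e1, e2, e3, ← ENNReal.ofReal_toReal htil,
    ← ENNReal.ofReal_add (integral_nonneg ht0) (integral_nonneg hd0),
    ← ENNReal.ofReal_add ENNReal.toReal_nonneg (integral_nonneg hnn)] at hd
  exact (ENNReal.ofReal_le_ofReal_iff
    (add_nonneg ENNReal.toReal_nonneg (integral_nonneg hnn))).1 hd

/-- The amount by which the weights `c` fail to cover a copy of `F`. -/
noncomputable def deficit (W : Graphon Ω) (F : SimpleGraph V) (c : Ω → ℝ) : (V → Ω) → ℝ :=
  (W.copies F).indicator fun x => max 0 (1 - ∑ i, c (x i))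

lemma deficit_nonneg (c : Ω → ℝ) (x : V → Ω) : 0 ≤ W.deficit F c x :=
  Set.indicator_nonneg (fun _ _ => le_max_left _ _) _

lemma deficit_le_one {c : Ω → ℝ} (hc : ∀ x, 0 ≤ c x) (x : V → Ω) : W.deficit F c x ≤ 1 := by
  refine Set.indicator_le' (fun x _ => ?_) (fun _ _ => zero_le_one) x
  exact max_le zero_le_one (by linarith [Finset.sum_nonneg fun i (_ : i ∈ Finset.univ) => hc (x i)])

lemma measurable_deficit {c : Ω → ℝ} (hc : Measurable c) : Measurable (W.deficit F c) :=
  Measurable.indicator (by fun_prop) (measurableSet_copies W F)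

/-- Where the deficit is positive, the weights sum to exactly 1 minus the deficit. -/
lemma deficit_mul_sum (c : Ω → ℝ) (x : V → Ω) :
    W.deficit F c x * ∑ i, c (x i) = W.deficit F c x - W.deficit F c x ^ 2 := by
  by_cases hx : x ∈ W.copies F
  · rw [deficit, Set.indicator_of_mem hx]
    rcases max_choice 0 (1 - ∑ i, c (x i)) with h | h <;> rw [h] <;> ring
  · simp [deficit, Set.indicator_of_notMem hx]

lemma integrable_deficit [IsProbabilityMeasure ν] {c : Ω → ℝ} (hcm : Measurable c)
    (hc : ∀ x, 0 ≤ c x) : Integrable (W.deficit F c) (Measure.pi fun _ : V => ν) :=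
  Integrable.of_bound (measurable_deficit hcm).aestronglyMeasurable 1 (ae_of_all _ fun x => by
    rw [Real.norm_of_nonneg (deficit_nonneg c x)]
    exact deficit_le_one hc x)

lemma integrable_deficit_sq [IsProbabilityMeasure ν] {c : Ω → ℝ} (hcm : Measurable c)
    (hc : ∀ x, 0 ≤ c x) :
    Integrable (fun x => W.deficit F c x ^ 2) (Measure.pi fun _ : V => ν) :=
  Integrable.of_bound ((measurable_deficit hcm).pow_const 2).aestronglyMeasurable 1
    (ae_of_all _ fun x => by
      rw [Real.norm_of_nonneg (sq_nonneg _)]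
      exact pow_le_one₀ (deficit_nonneg c x) (deficit_le_one hc x))

/-- The derivative of `u ↦ (u⁺)²` is 2-Lipschitz, so its first-order expansion errs by at most `h ^
2`. -/
lemma sq_max_zero_sub_le (u h : ℝ) : max 0 (u - h) ^ 2 ≤ max 0 u ^ 2 - 2 * h * max 0 u + h ^ 2 := by
  rcases max_cases 0 (u - h) with ⟨h1, h2⟩ | ⟨h1, h2⟩ <;>
    rcases max_cases 0 u with ⟨h3, h4⟩ | ⟨h3, h4⟩ <;> rw [h1, h3] <;>
    nlinarith [sq_nonneg (u - h), sq_nonneg h]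

/-- Second-order expansion of the squared deficit along a segment. -/
lemma sq_deficit_segment_le {c d : Ω → ℝ} (hc : ∀ x, c x ∈ Set.Icc (0 : ℝ) 1)
    (hd : ∀ x, d x ∈ Set.Icc (0 : ℝ) 1) (s : ℝ) (x : V → Ω) :
    W.deficit F (fun y => c y + s * (d y - c y)) x ^ 2
      ≤ W.deficit F c x ^ 2 - 2 * s * (W.deficit F c x * ∑ i, d (x i) - W.deficit F c x
          + W.deficit F c x ^ 2) + s ^ 2 * (Fintype.card V : ℝ) ^ 2 := by
  have h0 := deficit_mul_sum (W := W) (F := F) c x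
  by_cases hx : x ∈ W.copies F
  · have h1 : |∑ i, (d (x i) - c (x i))| ≤ Fintype.card V := by
      refine (Finset.abs_sum_le_sum_abs _ _).trans ?_
      calc _ ≤ ∑ i : V, (1 : ℝ) := Finset.sum_le_sum fun i _ => by
            rw [abs_le]
            constructor <;> linarith [(hc (x i)).1, (hc (x i)).2, (hd (x i)).1, (hd (x i)).2]
        _ = _ := by simp
    have h2 : (∑ i, (d (x i) - c (x i))) ^ 2 ≤ (Fintype.card V : ℝ) ^ 2 :=
      sq_le_sq.2 (h1.trans (le_abs_self _))
    have h3 := sq_max_zero_sub_le (1 - ∑ i, c (x i)) (s * ∑ i, (d (x i) - c (x i)))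
    have h4 : W.deficit F (fun y => c y + s * (d y - c y)) x
        = max 0 (1 - ∑ i, c (x i) - s * ∑ i, (d (x i) - c (x i))) := by
      rw [deficit, Set.indicator_of_mem hx, Finset.sum_add_distrib, Finset.mul_sum, sub_sub]
    have h5 : W.deficit F c x = max 0 (1 - ∑ i, c (x i)) := by
      rw [deficit, Set.indicator_of_mem hx]
    rw [← h4, ← h5] at h3
    have h6 := mul_le_mul_of_nonneg_left h2 (sq_nonneg s)
    rw [Finset.sum_sub_distrib] at h3 h6
    rw [mul_pow] at h3
    have h7 : 2 * (s * (∑ i, d (x i) - ∑ i, c (x i))) * W.deficit F c x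
        = 2 * s * (W.deficit F c x * ∑ i, d (x i) - W.deficit F c x * ∑ i, c (x i)) := by ring
    rw [h7, h0] at h3
    linarith
  · simp only [deficit, Set.indicator_of_notMem hx]
    simp only [ne_eq, OfNat.ofNat_ne_zero, not_false_eq_true, zero_pow, zero_mul, sub_self,
      add_zero, mul_zero, zero_add]
    positivity

/-- An approximate minimiser suffices: a step `s` from `c` towards the `d` of the trimming lemma
cannot lower the penalised cost by more than the slack. Dividing by `s` gives a first-order
condition, to which the trimming inequality is added. -/
lemma exists_integral_add_sq_deficit_le [IsProbabilityMeasure ν] (htil : til ν F W ≠ ∞)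
    {r δ : ℝ} (hr : 0 < r) (hδ : 0 < δ) :
    ∃ c : Ω → ℝ, Measurable c ∧ (∀ x, c x ∈ Set.Icc (0 : ℝ) 1) ∧
      ∫ x, c x ∂ν + 2 * r * ∫ x, W.deficit F c x ^ 2 ∂(Measure.pi fun _ : V => ν)
        ≤ (til ν F W).toReal + δ := by
  set μ := Measure.pi fun _ : V => ν with hμ
  set κ : ℝ := (Fintype.card V : ℝ) ^ 2 with hκ
  have hκ0 : 0 ≤ κ := by positivity
  -- Makes the second-order term `r * s * κ` at most `δ / 2`; minimality up to `s * (δ / 2)`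
  -- supplies the other half of `δ` after division by `s`.
  set s : ℝ := δ / (2 * (r * κ + δ)) with hs
  have hs0 : 0 < s := by positivity
  have hsmul : s * (2 * (r * κ + δ)) = δ := div_mul_cancel₀ _ (by positivity)
  have hs1 : s ≤ 1 := by
    rw [hs, div_le_one (by positivity)]
    nlinarith [mul_nonneg hr.le hκ0]
  set A : Set (Ω → ℝ) := {c | Measurable c ∧ ∀ x, c x ∈ Set.Icc (0 : ℝ) 1} with hA
  set Φ : (Ω → ℝ) → ℝ := fun c => ∫ x, c x ∂ν + r * ∫ x, W.deficit F c x ^ 2 ∂μ with hΦ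
  have hAint : ∀ c ∈ A, Integrable c ν := fun c hc =>
    Integrable.of_bound hc.1.aestronglyMeasurable 1 (ae_of_all _ fun x => by
      rw [Real.norm_of_nonneg (hc.2 x).1]
      exact (hc.2 x).2)
  have hbdd : BddBelow (Φ '' A) := by
    refine ⟨0, ?_⟩
    rintro _ ⟨c, hc, rfl⟩
    exact add_nonneg (integral_nonneg fun x => (hc.2 x).1)
      (mul_nonneg hr.le (integral_nonneg fun x => sq_nonneg _))
  have hAne : A.Nonempty := ⟨fun _ => 0, measurable_const, fun _ => by simp⟩
  obtain ⟨_, ⟨c, hc, rfl⟩, hcmin⟩ := Real.lt_sInf_add_pos (hAne.image Φ)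
    (show 0 < s * (δ / 2) by positivity)
  have hmin : ∀ c' ∈ A, Φ c ≤ Φ c' + s * (δ / 2) := fun c' hc' =>
    hcmin.le.trans (by gcongr; exact csInf_le hbdd ⟨c', hc', rfl⟩)
  have hc0 : ∀ x, 0 ≤ c x := fun x => (hc.2 x).1
  -- `2 * r * deficit` is the multiplier: minus the derivative of the penalty in the total weight of
  -- a copy.
  obtain ⟨d, hdm, hd, hdT⟩ := exists_integral_add_le_til_add htil
    (t := fun x => 2 * r * W.deficit F c x) ((measurable_deficit hc.1).const_mul _)
    (fun x hx => by
      by_contra h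
      exact hx (by simp [deficit, Set.indicator_of_notMem h]))
    (C := 2 * r) (fun x => mul_nonneg (by positivity) (deficit_nonneg c x))
    (fun x => mul_le_of_le_one_right (by positivity) (deficit_le_one hc0 x))
  refine ⟨c, hc.1, hc.2, ?_⟩
  have hdA : d ∈ A := ⟨hdm, hd⟩
  set c' : Ω → ℝ := fun y => c y + s * (d y - c y) with hc'
  have hc'A : c' ∈ A := by
    refine ⟨hc.1.add ((hdm.sub hc.1).const_mul s), fun x => ?_⟩
    have h1 := hc.2 x
    have h2 := hd x
    constructor <;> simp only [hc'] <;>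
      nlinarith [mul_nonneg hs0.le h2.1, mul_nonneg (sub_nonneg.2 hs1) h1.1,
        mul_nonneg hs0.le (sub_nonneg.2 h2.2), mul_nonneg (sub_nonneg.2 hs1) (sub_nonneg.2 h1.2)]
  have hDd : Integrable (fun x => W.deficit F c x * ∑ i, d (x i)) μ := by
    have hm := measurable_deficit (W := W) (F := F) hc.1
    refine Integrable.of_bound (by fun_prop) (Fintype.card V) (ae_of_all _ fun x => ?_)
    have h0 : 0 ≤ ∑ i, d (x i) := Finset.sum_nonneg fun i _ => (hd (x i)).1
    rw [Real.norm_of_nonneg (mul_nonneg (deficit_nonneg c x) h0)]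
    refine (mul_le_of_le_one_left h0 (deficit_le_one hc0 x)).trans ?_
    simpa using Finset.sum_le_sum fun i (_ : i ∈ Finset.univ) => (hd (x i)).2
  have hDi : Integrable (W.deficit F c) μ := integrable_deficit hc.1 hc0
  have hD2i : Integrable (fun x => W.deficit F c x ^ 2) μ := integrable_deficit_sq hc.1 hc0
  have hquad : ∫ x, W.deficit F c' x ^ 2 ∂μ ≤ ∫ x, W.deficit F c x ^ 2 ∂μ
      - 2 * s * (∫ x, W.deficit F c x * ∑ i, d (x i) ∂μ - ∫ x, W.deficit F c x ∂μ
          + ∫ x, W.deficit F c x ^ 2 ∂μ) + s ^ 2 * κ := by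
    have hi1 : Integrable (fun x => W.deficit F c x * ∑ i, d (x i) - W.deficit F c x) μ :=
      hDd.sub hDi
    have hi2 : Integrable (fun x => 2 * s * (W.deficit F c x * ∑ i, d (x i) - W.deficit F c x
        + W.deficit F c x ^ 2)) μ := (hi1.add hD2i).const_mul _
    rw [← integral_sub hDd hDi, ← integral_add hi1 hD2i, ← integral_const_mul,
      ← integral_sub hD2i hi2]
    calc ∫ x, W.deficit F c' x ^ 2 ∂μ
        ≤ ∫ x, (W.deficit F c x ^ 2 - 2 * s * (W.deficit F c x * ∑ i, d (x i) - W.deficit F c x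
          + W.deficit F c x ^ 2) + s ^ 2 * κ) ∂μ :=
          integral_mono (integrable_deficit_sq hc'A.1 fun x => (hc'A.2 x).1)
            ((hD2i.sub hi2).add (integrable_const _))
            fun x => sq_deficit_segment_le hc.2 hd s x
      _ = _ := by
          rw [integral_add (f := fun x => W.deficit F c x ^ 2 - 2 * s * (W.deficit F c x *
            ∑ i, d (x i) - W.deficit F c x + W.deficit F c x ^ 2))
            (hD2i.sub hi2) (integrable_const _)]
          simp [hμ]
  have hlin : ∫ x, c' x ∂ν = ∫ x, c x ∂ν + s * (∫ x, d x ∂ν - ∫ x, c x ∂ν) := by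
    rw [← integral_sub (hAint d hdA) (hAint c hc), ← integral_const_mul, ← integral_add (hAint c hc)]
    exact ((hAint d hdA).sub (hAint c hc)).const_mul s
  have hm := hmin c' hc'A
  simp only [hΦ] at hm
  rw [hlin] at hm
  simp only [mul_assoc, integral_const_mul] at hdT
  set P := ∫ x, W.deficit F c x ∂μ
  set Q := ∫ x, W.deficit F c x ^ 2 ∂μ
  set R := ∫ x, W.deficit F c x * ∑ i, d (x i) ∂μ
  set I := ∫ x, c x ∂ν
  set J := ∫ x, d x ∂ν
  have hrq := mul_le_mul_of_nonneg_left hquad hr.le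
  have hkey : 0 ≤ s * (J - I - 2 * r * (R - P + Q) + r * s * κ + δ / 2) := by nlinarith
  have hpos := nonneg_of_mul_nonneg_right hkey hs0
  have hsk : r * s * κ ≤ δ / 2 := by nlinarith [mul_pos hs0 hδ]
  nlinarith

/-! ### Passage to the limit -/

lemma deficit_midpoint_sq_le (c d : Ω → ℝ) (x : V → Ω) :
    W.deficit F (fun y => (c y + d y) / 2) x ^ 2
      ≤ (W.deficit F c x ^ 2 + W.deficit F d x ^ 2) / 2 := by
  by_cases hx : x ∈ W.copies F
  · simp only [deficit, Set.indicator_of_mem hx]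
    rw [← Finset.sum_div, Finset.sum_add_distrib]
    set a := ∑ i, c (x i)
    set b := ∑ i, d (x i)
    have h : max 0 (1 - (a + b) / 2) ≤ (max 0 (1 - a) + max 0 (1 - b)) / 2 :=
      max_le (by positivity) (by linarith [le_max_right 0 (1 - a), le_max_right 0 (1 - b)])
    calc _ ≤ ((max 0 (1 - a) + max 0 (1 - b)) / 2) ^ 2 := by gcongr
      _ ≤ _ := by nlinarith [sq_nonneg (max 0 (1 - a) - max 0 (1 - b))]
  · simp [deficit, Set.indicator_of_notMem hx]

open Filter Topology in
/-- Strong duality: some fractional cover is no larger than the supremum of the tilings. -/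
lemma fcov_le_til [IsProbabilityMeasure ν] : fcov ν F W ≤ til ν F W := by
  -- This occurs when `V` is empty: tilings are then unconstrained and no cover exists.
  by_cases htil : til ν F W = ∞
  · simp [htil]
  set μ := Measure.pi fun _ : V => ν with hμ
  set T := (til ν F W).toReal with hT
  have hT0 : 0 ≤ T := ENNReal.toReal_nonneg
  set ε : ℕ → ℝ := fun n => 1 / ((n : ℝ) + 1) with hε
  have hεpos : ∀ n, 0 < ε n := fun n => by positivity
  have hε1 : ∀ n, ε n ≤ 1 := fun n => by
    rw [hε, div_le_one (by positivity)]
    linarith [(Nat.cast_nonneg n : (0 : ℝ) ≤ n)]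
  have hεanti : Antitone ε := fun m n hmn => Nat.one_div_le_one_div hmn
  have hεlim : Tendsto ε atTop (𝓝 0) := tendsto_one_div_add_atTop_nhds_zero_nat
  set K : ℕ → Set (Ω → ℝ) := fun n => {c | Measurable c ∧ (∀ x, c x ∈ Set.Icc (0 : ℝ) 1) ∧
    ∫ x, c x ∂ν ≤ T + ε n ∧ ∫ x, W.deficit F c x ^ 2 ∂μ ≤ ε n} with hK
  have hint : ∀ n, ∀ c ∈ K n, Integrable c ν := fun n c hc =>
    Integrable.of_bound hc.1.aestronglyMeasurable 1 (ae_of_all _ fun x => by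
      rw [Real.norm_of_nonneg (hc.2.1 x).1]
      exact (hc.2.1 x).2)
  have hint2 : ∀ n, ∀ c ∈ K n, Integrable (fun x => W.deficit F c x ^ 2) μ := fun n c hc =>
    integrable_deficit_sq hc.1 fun x => (hc.2.1 x).1
  obtain ⟨f, c, hfK, hcm, hc, hlim⟩ :=
    exists_ae_tendsto_of_antitone_of_midpoint_mem (ν := ν) (K := K)
      (fun m n hmn c hc => ⟨hc.1, hc.2.1, hc.2.2.1.trans (by gcongr; exact hεanti hmn),
        hc.2.2.2.trans (hεanti hmn)⟩)
      (fun n => by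
        -- With this `r` the penalty bound `r * ∫ D² ≤ T + 1` reads `∫ D² ≤ ε n`.
        obtain ⟨c, hcm, hc, h⟩ := exists_integral_add_sq_deficit_le (ν := ν) htil
          (r := (T + 1) / ε n) (div_pos (by linarith) (hεpos n)) (hεpos n)
        have hI : 0 ≤ ∫ x, c x ∂ν := integral_nonneg fun x => (hc x).1
        have hQ : 0 ≤ ∫ x, W.deficit F c x ^ 2 ∂μ := integral_nonneg fun x => sq_nonneg _
        have hr : 0 ≤ (T + 1) / ε n := div_nonneg (by linarith) (hεpos n).le
        refine ⟨c, hcm, hc, by linarith [mul_nonneg hr hQ], ?_⟩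
        have h1 : (T + 1) / ε n * ∫ x, W.deficit F c x ^ 2 ∂μ ≤ T + 1 := by
          linarith [mul_nonneg hr hQ, hε1 n]
        rw [div_mul_eq_mul_div, div_le_iff₀ (hεpos n)] at h1
        exact le_of_mul_le_mul_left h1 (by linarith))
      (fun n c hc => hc.1) (fun n c hc => hc.2.1)
      (fun n c hc d hd => by
        refine ⟨(hc.1.add hd.1).div_const 2, fun x => ?_, ?_, ?_⟩
        · have h1 := hc.2.1 x
          have h2 := hd.2.1 x
          constructor <;> linarith [h1.1, h1.2, h2.1, h2.2]
        · rw [integral_div, integral_add (hint n c hc) (hint n d hd)]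
          linarith [hc.2.2.1, hd.2.2.1]
        · have hi : Integrable (fun x => (W.deficit F c x ^ 2 + W.deficit F d x ^ 2) / 2) μ :=
            ((hint2 n c hc).add (hint2 n d hd)).div_const 2
          refine (integral_mono_of_nonneg (ae_of_all _ fun x => sq_nonneg _) hi
            (ae_of_all _ fun x => deficit_midpoint_sq_le c d x)).trans ?_
          rw [integral_div, integral_add (hint2 n c hc) (hint2 n d hd)]
          linarith [hc.2.2.2, hd.2.2.2])
  have hI : ∫ x, c x ∂ν ≤ T := by
    have h := tendsto_integral_of_dominated_convergence (fun _ => (1 : ℝ))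
      (fun n => (hfK n).1.aestronglyMeasurable) (integrable_const _)
      (fun n => ae_of_all _ fun x => by
        rw [Real.norm_of_nonneg ((hfK n).2.1 x).1]
        exact ((hfK n).2.1 x).2) hlim
    simpa using le_of_tendsto_of_tendsto' h (tendsto_const_nhds.add hεlim)
      fun n => (hfK n).2.2.1
  have hlimV : ∀ᵐ x ∂μ, Tendsto (fun n => W.deficit F (f n) x ^ 2) atTop
      (𝓝 (W.deficit F c x ^ 2)) := by
    have h : ∀ᵐ x ∂μ, ∀ i, Tendsto (fun n => f n (x i)) atTop (𝓝 (c (x i))) :=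
      ae_all_iff.2 fun i => (Measure.quasiMeasurePreserving_eval (fun _ : V => ν) i).ae hlim
    filter_upwards [h] with x hx
    by_cases hxc : x ∈ W.copies F
    · simp only [deficit, Set.indicator_of_mem hxc]
      exact (tendsto_const_nhds.max
        (tendsto_const_nhds.sub (tendsto_finsetSum _ fun i _ => hx i))).pow 2
    · simp [deficit, Set.indicator_of_notMem hxc]
  have hQ : ∫ x, W.deficit F c x ^ 2 ∂μ = 0 := by
    refine le_antisymm ?_ (integral_nonneg fun x => sq_nonneg _)
    have h := tendsto_integral_of_dominated_convergence (fun _ => (1 : ℝ))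
      (fun n => ((measurable_deficit (hfK n).1).pow_const 2).aestronglyMeasurable)
      (integrable_const _)
      (fun n => ae_of_all _ fun x => by
        rw [Real.norm_of_nonneg (sq_nonneg _)]
        exact pow_le_one₀ (deficit_nonneg _ x)
          (deficit_le_one (fun y => ((hfK n).2.1 y).1) x)) hlimV
    exact le_of_tendsto_of_tendsto' h hεlim fun n => (hfK n).2.2.2
  have hzero : ∀ᵐ x ∂μ, W.deficit F c x ^ 2 = 0 :=
    (integral_eq_zero_iff_of_nonneg (fun x => sq_nonneg _)
      (integrable_deficit_sq hcm fun x => (hc x).1)).1 hQ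
  have hcover : IsFractionalCover ν W F fun x => (c x).toNNReal := by
    refine ⟨hcm.real_toNNReal, fun x => Real.toNNReal_le_one.2 (hc x).2, ?_⟩
    refine measure_mono_null ?_ (ae_iff.1 hzero)
    rintro x ⟨hxc, hx⟩ h0
    have h1 : ∑ i, c (x i) < 1 := by
      have : ((∑ i, (c (x i)).toNNReal : ℝ≥0) : ℝ) < 1 := by exact_mod_cast hx
      rw [NNReal.coe_sum] at this
      simpa only [Real.coe_toNNReal _ (hc _).1] using this
    have h2 : W.deficit F c x = 0 := pow_eq_zero_iff (two_ne_zero) |>.1 h0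
    rw [deficit, Set.indicator_of_mem hxc] at h2
    linarith [le_max_right 0 (1 - ∑ i, c (x i))]
  calc fcov ν F W ≤ ∫⁻ x, ((c x).toNNReal : ℝ≥0∞) ∂ν :=
        iInf₂_le (f := fun (c : Ω → ℝ≥0) (_ : IsFractionalCover ν W F c) =>
          ∫⁻ x, (c x : ℝ≥0∞) ∂ν) _ hcover
    _ = ENNReal.ofReal (∫ x, c x ∂ν) := by
        rw [ofReal_integral_eq_lintegral_ofReal _ (ae_of_all _ fun x => (hc x).1)]
        · rfl
        · exact Integrable.of_bound hcm.aestronglyMeasurable 1 (ae_of_all _ fun x => by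
            rw [Real.norm_of_nonneg (hc x).1]
            exact (hc x).2)
    _ ≤ til ν F W := ENNReal.ofReal_le_of_le_toReal hI

end Deficit

end Graphon

theorem theorem3p12 {Ω : Type*} [MeasurableSpace Ω] [StandardBorelSpace Ω]
    (ν : MeasureTheory.Measure Ω) [MeasureTheory.IsProbabilityMeasure ν]
    [MeasureTheory.NullSingletonClass ν] {V : Type*} [Fintype V]
    (F : SimpleGraph V) (W : Graphon Ω) :
    Graphon.til ν F W = Graphon.fcov ν F W :=
  le_antisymm Graphon.til_le_fcov Graphon.fcov_le_til
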